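/- For a small category $\mathbb{A}$ write $\widehat{\mathbb{A}}=\mathbf{Set}^{\mathbb{A}^{\mathrm{op}}}$ for its presheaf category, and let $!\mathbb{A}$ be the free symmetric strict monoidal completion of $\mathbb{A}$: its objects are the finite sequences $A=(A_i)_{i<n}$ of objects of $\mathbb{A}$, and a morphism $(A_i)_{i<n}\to(B_j)_{j<m}$ is a bijection $\sigma:\{0,\dots,n-1\}\to\{0,\dots,m-1\}$ together with morphisms $A_i\to B_{\sigma i}$ in $\mathbb{A}$ for all $i<n$. Let $S_{\mathbb{A}}:{!\mathbb{A}}\to\widehat{\mathbb{A}}$ be the sum functor $S_{\mathbb{A}}(A)=\sum_{i<n} \mathrm{y}(A_i)$, where $\mathrm{y}$ is the Yoneda embedding. A functor $F:\widehat{\mathbb{A}}\to\widehat{\mathbb{B}}$ is \emph{analytic} if it is a left Kan extension along $S_{\mathbb{A}}$ of some functor $P:{!\mathbb{A}}\to\widehat{\mathbb{B}}$. A commutative square is a \emph{quasi-pullback} if the mediating morphism from its span to the pullback of its cospan is an epimorphism, and a natural transformation is \emph{quasi-cartesian} if all its naturality squares are quasi-pullbacks. \textbf{Corollary.} Small groupoids,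 analytic functors between their presheaf categories, and quasi-cartesian natural transformations between these functors form a 2-category $\mathbf{AF}$, with the identities and compositions of functors and natural transformations. Explicitly: for small groupoids $\mathbb{G},\mathbb{H},\mathbb{K}$, (i) the identity functor on $\widehat{\mathbb{G}}$ is analytic; (ii) if $F:\widehat{\mathbb{G}}\to\widehat{\mathbb{H}}$ and $L:\widehat{\mathbb{H}}\to\widehat{\mathbb{K}}$ are analytic, then so is the composite $L F$; (iii) the identity transformation of an analytic functor $\widehat{\mathbb{G}}\to\widehat{\mathbb{H}}$ is quasi-cartesian; (iv) quasi-cartesian transformations between analytic functors $\widehat{\mathbb{G}}\to\widehat{\mathbb{H}}$ are closed under vertical composition; (v) if $\varphi:F\Rightarrow F'$ is a quasi-cartesian transformation between analytic functors $\widehat{\mathbb{G}}\to\widehat{\mathbb{H}}$ and $\psi:L\Rightarrow L'$ is one between analytic functors $\widehat{\mathbb{H}}\to\widehat{\mathbb{K}}$, then the horizontal composite $L F\Rightarrow L' F'$ of $\varphi$ and $\psi$ is quasi-cartesian; and, with these operations, the small groupoids, analytic functors and quasi-cartesian transformations satisfy the axioms of a (strict) 2-category. -/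

import Mathlib

open CategoryTheory CategoryTheory.Limits Opposite

universe u

namespace AnalyticFunctors

/-- The category of presheaves (of sets) over a small category. -/
abbrev PSh (A : Type u) [Category.{u} A] : Type (u + 1) := Aᵒᵖ ⥤ Type u

section FreeSMC

/-- Objects of the free symmetric strict monoidal completion `!A` of a small category `A`:
functions from a finite cardinal to (the objects of) `A`. -/
structure FreeSMC (A : Type u) : Type u where
  card : ℕ
  obj : Fin card → A

namespace FreeSMC

variable {A : Type u} [Category.{u} A]

/-- Morphisms `C ⟶ D` of `!A`: a bijection of index sets `σ`, together with a family of morphisms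
`C i ⟶ D (σ i)` of `A`. -/
@[ext]
structure Hom (C D : FreeSMC A) : Type u where
  ind : Fin C.card ≃ Fin D.card
  comp : ∀ i, C.obj i ⟶ D.obj (ind i)

instance : Category.{u} (FreeSMC A) where
  Hom C D := Hom C D
  id C := ⟨Equiv.refl _, fun i => 𝟙 (C.obj i)⟩
  comp f g := ⟨f.ind.trans g.ind, fun i => f.comp i ≫ g.comp (f.ind i)⟩
  id_comp _ := Hom.ext rfl (heq_of_eq (funext fun _ => Category.id_comp _))
  comp_id _ := Hom.ext rfl (heq_of_eq (funext fun _ => Category.comp_id _))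
  assoc _ _ _ := Hom.ext rfl (heq_of_eq (funext fun _ => Category.assoc _ _ _))

/-- The presheaf `S C = ∑ i, y (C i)`, the coproduct of representables being computed pointwise. -/
def sumObj (C : FreeSMC A) : PSh A where
  obj a := Σ i : Fin C.card, (unop a ⟶ C.obj i)
  map g := TypeCat.ofHom fun x => ⟨x.1, g.unop ≫ x.2⟩
  map_id a := by ext x <;> simp
  map_comp g h := by ext x <;> simp

/-- The action of `S` on morphisms: `S γ` sends the summand `y (C i)` into the summand
`y (D (σ i))` by composition with the `i`-th component of `γ`. -/
def sumMap {C D : FreeSMC A} (γ : C ⟶ D) : sumObj C ⟶ sumObj D where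
  app a := TypeCat.ofHom fun x => ⟨Hom.ind γ x.1, x.2 ≫ Hom.comp γ x.1⟩
  naturality a b g := by
    ext x
    exact Sigma.ext rfl (heq_of_eq (Category.assoc g.unop x.2 _))

variable (A) in
/-- The sum functor `S : !A ⥤ PSh A`, which extends the Yoneda embedding. -/
def sumFunctor : FreeSMC A ⥤ PSh A where
  obj := sumObj
  map := sumMap
  map_id C := by
    ext a x
    exact Sigma.ext rfl (heq_of_eq (Category.comp_id x.2))
  map_comp f g := by
    ext a x
    exact Sigma.ext rfl (heq_of_eq (Category.assoc x.2 _ _).symm)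

/-- The `i`-th coproduct injection `y (C i) ⟶ S C`. -/
def sumInj (C : FreeSMC A) (i : Fin C.card) : yoneda.obj (C.obj i) ⟶ sumObj C where
  app a := TypeCat.ofHom fun x => ⟨i, x⟩
  naturality a b g := by ext x; simp [sumObj]

/-- `S C` is the coproduct in `PSh A` of the representables `y (C i)`. -/
theorem nonempty_isColimit_sumObj (C : FreeSMC A) :
    Nonempty (IsColimit (Cofan.mk (sumObj C) (sumInj C))) := by
  refine ⟨Cofan.IsColimit.mk _ (fun s => ⟨fun a => TypeCat.ofHom fun x => (s.inj x.1).app a x.2, ?_⟩)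
    ?_ ?_⟩
  · intro a b g
    ext x
    have h := (s.inj x.1).naturality g
    exact ConcreteCategory.congr_hom h x.2
  · intro s i
    rfl
  · intro s m h
    ext a x
    have hx := ConcreteCategory.congr_hom (congrArg (fun t => NatTrans.app t a) (h x.1)) x.2
    exact hx

end FreeSMC

end FreeSMC

section Notions

variable {A B : Type u} [Category.{u} A] [Category.{u} B]

/-- A functor `F : PSh A ⥤ PSh B` is analytic if it is a left Kan extension of some functor
`P : !A ⥤ PSh B` along the sum functor `S : !A ⥤ PSh A`. -/
def IsAnalytic (F : PSh A ⥤ PSh B) : Prop :=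
  ∃ (P : FreeSMC A ⥤ PSh B) (α : P ⟶ FreeSMC.sumFunctor A ⋙ F), F.IsLeftKanExtension α

/-- A commutative square with sides `h : Q ⟶ X`, `k : Q ⟶ Y`, `f : X ⟶ Z` and `g : Y ⟶ Z` is a
quasi-pullback if the mediating morphism from `Q` to the pullback of `f` and `g` is epi. -/
def IsQuasiPullback {C : Type*} [Category* C] [HasPullbacks C] {Q X Y Z : C}
    (h : Q ⟶ X) (k : Q ⟶ Y) (f : X ⟶ Z) (g : Y ⟶ Z) : Prop :=
  ∃ w : h ≫ f = k ≫ g, Epi (pullback.lift h k w)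

/-- A natural transformation is quasi-cartesian if all its naturality squares are
quasi-pullbacks. -/
def QuasiCartesian {C D : Type*} [Category* C] [Category* D] [HasPullbacks D] {F G : C ⥤ D}
    (φ : F ⟶ G) : Prop :=
  ∀ ⦃X Y : C⦄ (f : X ⟶ Y), IsQuasiPullback (F.map f) (φ.app X) (φ.app Y) (G.map f)

end Notions

/-- The closure properties under which analytic functors and quasi-cartesian transformations
inherit the identities and the compositions (of functors, and vertical and horizontal of natural
transformations) of the 2-category of categories. -/
structure Closed : Prop where
  id_analytic : ∀ (G : Type u) [Groupoid.{u} G], IsAnalytic (𝟭 (PSh G))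
  comp_analytic : ∀ (G H K : Type u) [Groupoid.{u} G] [Groupoid.{u} H] [Groupoid.{u} K]
    (F : PSh G ⥤ PSh H) (L : PSh H ⥤ PSh K),
    IsAnalytic F → IsAnalytic L → IsAnalytic (F ⋙ L)
  id_quasiCartesian : ∀ (G H : Type u) [Groupoid.{u} G] [Groupoid.{u} H]
    (F : PSh G ⥤ PSh H), IsAnalytic F → QuasiCartesian (𝟙 F)
  vcomp_quasiCartesian : ∀ (G H : Type u) [Groupoid.{u} G] [Groupoid.{u} H]
    (F F' F'' : PSh G ⥤ PSh H) (φ : F ⟶ F') (ψ : F' ⟶ F''),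
    IsAnalytic F → IsAnalytic F' → IsAnalytic F'' →
    QuasiCartesian φ → QuasiCartesian ψ → QuasiCartesian (φ ≫ ψ)
  hcomp_quasiCartesian : ∀ (G H K : Type u) [Groupoid.{u} G] [Groupoid.{u} H] [Groupoid.{u} K]
    (F F' : PSh G ⥤ PSh H) (L L' : PSh H ⥤ PSh K) (φ : F ⟶ F') (ψ : L ⟶ L'),
    IsAnalytic F → IsAnalytic F' → IsAnalytic L → IsAnalytic L' →
    QuasiCartesian φ → QuasiCartesian ψ → QuasiCartesian (φ ◫ ψ)

/-- The objects of the 2-category `AF`: small groupoids. -/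
structure AF : Type (u + 1) where
  carrier : Type u
  [str : Groupoid.{u} carrier]

namespace AF

attribute [instance] AF.str

/-- The 1-cells `G ⟶ H` of `AF`: analytic functors `PSh G ⥤ PSh H`. -/
structure Hom (G H : AF.{u}) : Type (u + 1) where
  functor : PSh G.carrier ⥤ PSh H.carrier
  isAnalytic : IsAnalytic functor

/-- The 2-cells of `AF`: quasi-cartesian natural transformations. -/
@[ext]
structure Hom₂ {G H : AF.{u}} (F F' : Hom G H) : Type (u + 1) where
  trans : F.functor ⟶ F'.functor
  quasiCartesian : QuasiCartesian trans

/-- The category `AF(G, H)`, with the identities and the composition of the category of functors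
and natural transformations. -/
abbrev homCategory (h : Closed.{u}) (G H : AF.{u}) :
    Category.{u + 1} (Hom G H) where
  Hom F F' := Hom₂ F F'
  id F := ⟨𝟙 F.functor, h.id_quasiCartesian _ _ _ F.isAnalytic⟩
  comp {F F' F''} φ ψ := ⟨φ.trans ≫ ψ.trans, h.vcomp_quasiCartesian _ _ _ _ _ _ _
    F.isAnalytic F'.isAnalytic F''.isAnalytic φ.quasiCartesian ψ.quasiCartesian⟩
  id_comp _ := Hom₂.ext (Category.id_comp _)
  comp_id _ := Hom₂.ext (Category.comp_id _)
  assoc _ _ _ := Hom₂.ext (Category.assoc _ _ _)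

theorem comp_trans (h : Closed.{u}) {G H : AF.{u}} {F F' F'' : Hom G H} (φ : Hom₂ F F')
    (ψ : Hom₂ F' F'') :
    Hom₂.trans (@CategoryStruct.comp _ (homCategory h G H).toCategoryStruct F F' F'' φ ψ) =
      φ.trans ≫ ψ.trans := rfl

theorem id_trans (h : Closed.{u}) {G H : AF.{u}} (F : Hom G H) :
    Hom₂.trans (@CategoryStruct.id _ (homCategory h G H).toCategoryStruct F) = 𝟙 F.functor := rfl

/-- The identities and the composition of 1-cells: those of functors. -/
abbrev categoryStruct (h : Closed.{u}) : CategoryStruct.{u + 1} AF.{u} where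
  Hom G H := Hom G H
  id G := ⟨𝟭 _, h.id_analytic _⟩
  comp F L := ⟨F.functor ⋙ L.functor, h.comp_analytic _ _ _ _ _ F.isAnalytic L.isAnalytic⟩

/-- The bicategory structure on `AF`, all of whose operations are those of functors and natural
transformations: whiskering is horizontal composition with an identity transformation, and the
structural isomorphisms are identities, as composition of functors is strict. -/
abbrev bicategory (h : Closed.{u}) : Bicategory.{u + 1, u + 1} AF.{u} where
  toCategoryStruct := categoryStruct h
  homCategory _ _ := homCategory h _ _
  whiskerLeft {_ _ _} F {L L'} ψ := ⟨𝟙 F.functor ◫ ψ.trans,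
    h.hcomp_quasiCartesian _ _ _ _ _ _ _ _ _ F.isAnalytic F.isAnalytic L.isAnalytic L'.isAnalytic
      (h.id_quasiCartesian _ _ _ F.isAnalytic) ψ.quasiCartesian⟩
  whiskerRight {_ _ _ F F'} φ L := ⟨φ.trans ◫ 𝟙 L.functor,
    h.hcomp_quasiCartesian _ _ _ _ _ _ _ _ _ F.isAnalytic F'.isAnalytic L.isAnalytic L.isAnalytic
      φ.quasiCartesian (h.id_quasiCartesian _ _ _ L.isAnalytic)⟩
  associator {G _ _ M} F L N :=
    letI := homCategory h G M
    Iso.refl (⟨F.functor ⋙ L.functor ⋙ N.functor, h.comp_analytic _ _ _ _ _ F.isAnalytic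
      (h.comp_analytic _ _ _ _ _ L.isAnalytic N.isAnalytic)⟩ : Hom G M)
  leftUnitor F := letI := homCategory h; Iso.refl F
  rightUnitor F := letI := homCategory h; Iso.refl F
  whiskerLeft_id F L := Hom₂.ext <| NatTrans.ext <| funext fun X => by
    simp [id_trans h]; rfl
  whiskerLeft_comp _ _ _ _ _ _ := Hom₂.ext <| NatTrans.ext <| funext fun X => by
    simp [comp_trans h]
  id_whiskerLeft _ := Hom₂.ext <| NatTrans.ext <| funext fun X => by
    simp [comp_trans h, id_trans h]; exact (Category.id_comp _).symm
  comp_whiskerLeft _ _ _ _ _ := Hom₂.ext <| NatTrans.ext <| funext fun X => by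
    simp [comp_trans h, id_trans h]
    exact ((Category.id_comp _).trans (Category.id_comp _)).symm
  id_whiskerRight _ _ := Hom₂.ext <| NatTrans.ext <| funext fun X => by
    simp [id_trans h]; rfl
  comp_whiskerRight _ _ _ := Hom₂.ext <| NatTrans.ext <| funext fun X => by
    simp [comp_trans h]
  whiskerRight_id _ := Hom₂.ext <| NatTrans.ext <| funext fun X => by
    simp [comp_trans h, id_trans h]; exact (Category.id_comp _).symm
  whiskerRight_comp _ _ _ := Hom₂.ext <| NatTrans.ext <| funext fun X => by
    simp [comp_trans h, id_trans h]
    exact ((Category.id_comp _).trans (Category.id_comp _)).symm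
  whisker_assoc _ _ _ _ _ := Hom₂.ext <| NatTrans.ext <| funext fun X => by
    simp [comp_trans h, id_trans h]
    exact ((Category.id_comp _).trans (Category.comp_id _)).symm
  whisker_exchange _ _ := Hom₂.ext <| NatTrans.ext <| funext fun X => by
    simp [comp_trans h]
  pentagon _ _ _ N := Hom₂.ext <| NatTrans.ext <| funext fun X => by
    simp [comp_trans h, id_trans h]
    exact (congrArg (· ≫ _) (N.functor.map_id _)).trans (Category.id_comp _)
  triangle _ L := Hom₂.ext <| NatTrans.ext <| funext fun X => by
    simp [comp_trans h, id_trans h]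
    exact (Category.id_comp _).trans (L.functor.map_id _).symm

end AF

end AnalyticFunctors

open AnalyticFunctors

/-!
The functor `S : !A ⥤ PSh A` makes an analytic functor recognisable by its *generic elements*. An
element `t` of `F T` is generic (`IsGeneric`) if every equation `F b y = F a t` lifts to a map `c`
with `c ≫ b = a` and `F c t = y`. Over groupoids, `F` is analytic if and only if every element of
`F` is the image of a generic element over some finite sum of representables `S C`
(`HasEnoughGenerics`).

* If `F` is the Kan extension of `P`, then `F X` is the colimit of `P` over the comma category
  `S ↓ X`. This comma category is a groupoid since `!A` is one, so that equality in the colimit is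
  witnessed by a single map; hence the elements of `P C`, seen in `F (S C)`, are generic
  (`IsAnalytic.hasEnoughGenerics`).
* Conversely, let `P C` consist of the generic elements of `F (S C)`. Two generic elements with a
  common image are related by an isomorphism `S C ≅ S D`, and such isomorphisms come from `!A`.
  So `F` is the pointwise Kan extension of `P` (`HasEnoughGenerics.isAnalytic`).

Having enough generics is evidently true of the identity, by the Yoneda lemma, and stable under
composition, since finite sums of the `S C` are again of this form (`HasEnoughGenerics.comp`). It
also implies that quasi-pullbacks are preserved, because the `S C` are projective
(`HasEnoughGenerics.map_isQuasiPullback`). The naturality square of a horizontal composite at `f`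
is the pasting of the square of `ψ` at `F f` with the image under `L'` of the square of `φ` at `f`,
and quasi-pullbacks of presheaves, described elementwise in `isQuasiPullback_iff`, can be pasted.
-/

namespace AnalyticFunctors

/-! ### Maps out of finite sums of representables -/

namespace FreeSMC

variable {A : Type u} [Category.{u} A]

/-- The generic element of the `i`-th summand of `S C`, corresponding to the `i`-th coproduct
injection by the Yoneda lemma. -/
def gen (C : FreeSMC A) (i : Fin C.card) : (sumObj C).obj (op (C.obj i)) := ⟨i, 𝟙 (C.obj i)⟩

theorem map_gen (C : FreeSMC A) {a : Aᵒᵖ} (s : (sumObj C).obj a) :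
    (sumObj C).map s.2.op (C.gen s.1) = s :=
  Sigma.ext rfl (heq_of_eq (Category.comp_id s.2))

theorem sumObj_hom_ext {C : FreeSMC A} {X : PSh A} {f g : sumObj C ⟶ X}
    (h : ∀ i, f.app _ (C.gen i) = g.app _ (C.gen i)) : f = g := by
  refine NatTrans.ext (funext fun a => ConcreteCategory.hom_ext _ _ fun s => ?_)
  rw [← map_gen C s, NatTrans.naturality_apply, NatTrans.naturality_apply, h]

/-- The map `S C ⟶ X` with prescribed values at the generic elements of the summands. -/
def ofElements (C : FreeSMC A) {X : PSh A} (x : ∀ i, X.obj (op (C.obj i))) : sumObj C ⟶ X where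
  app a := TypeCat.ofHom fun s => X.map s.2.op (x s.1)
  naturality a b g := by
    ext s
    exact ConcreteCategory.congr_hom (X.map_comp s.2.op g) (x s.1)

@[simp]
theorem ofElements_gen (C : FreeSMC A) {X : PSh A} (x : ∀ i, X.obj (op (C.obj i)))
    (i : Fin C.card) : (C.ofElements x).app _ (C.gen i) = x i :=
  ConcreteCategory.congr_hom (X.map_id _) (x i)

/-- A map between sums of representables acts on indices by a function, which is its action on the
indices of the generic elements. -/
theorem app_fst {C D : FreeSMC A} (f : sumObj C ⟶ sumObj D) {a : Aᵒᵖ} (s : (sumObj C).obj a) :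
    (f.app a s).1 = (f.app _ (C.gen s.1)).1 := by
  conv_lhs => rw [← map_gen C s, NatTrans.naturality_apply]
  rfl

/-- The sum functor is full on isomorphisms. -/
theorem exists_sumMap_eq {C D : FreeSMC A} (e : sumObj C ≅ sumObj D) :
    ∃ γ : C ⟶ D, sumMap γ = e.hom := by
  have key : ∀ {C D : FreeSMC A} (e : sumObj C ≅ sumObj D) (i : Fin C.card),
      (e.inv.app _ (D.gen (e.hom.app _ (C.gen i)).1)).1 = i := fun {C D} e i => by
    rw [← app_fst e.inv]
    exact congrArg Sigma.fst (ConcreteCategory.congr_hom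
      (congrArg (fun t => NatTrans.app t (op (C.obj i))) e.hom_inv_id) (C.gen i))
  refine ⟨⟨⟨fun i => (e.hom.app _ (C.gen i)).1, fun j => (e.inv.app _ (D.gen j)).1,
    key e, key e.symm⟩, fun i => (e.hom.app _ (C.gen i)).2⟩, sumObj_hom_ext fun i => ?_⟩
  exact Sigma.ext rfl (heq_of_eq (Category.id_comp _))

instance : (sumFunctor A).Faithful where
  map_injective {C D} γ δ h := by
    have h' : ∀ i, (⟨Hom.ind γ i, Hom.comp γ i⟩ : (sumObj D).obj (op (C.obj i))) =
        ⟨Hom.ind δ i, Hom.comp δ i⟩ := fun i => by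
      have := ConcreteCategory.congr_hom
        (congrArg (fun t => NatTrans.app t (op (C.obj i))) h) (C.gen i)
      refine Eq.trans ?_ (this.trans ?_)
      · exact Sigma.ext rfl (heq_of_eq (Category.id_comp _).symm)
      · exact Sigma.ext rfl (heq_of_eq (Category.id_comp _))
    have hind : Hom.ind γ = Hom.ind δ := Equiv.ext fun i => congrArg Sigma.fst (h' i)
    refine Hom.ext hind (Function.hfunext rfl fun i j hij => ?_)
    obtain rfl := eq_of_heq hij
    exact (Sigma.ext_iff.1 (h' i)).2

theorem isIso_of_isIso_sumMap {C D : FreeSMC A} (γ : C ⟶ D) (h : IsIso (sumMap γ)) :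
    IsIso γ := by
  obtain ⟨δ, hδ⟩ := exists_sumMap_eq (asIso (sumMap γ)).symm
  refine ⟨δ, (sumFunctor A).map_injective ?_, (sumFunctor A).map_injective ?_⟩
  · rw [(sumFunctor A).map_comp, (sumFunctor A).map_id]
    change sumMap γ ≫ sumMap δ = _
    rw [hδ]
    exact IsIso.hom_inv_id (sumMap γ)
  · rw [(sumFunctor A).map_comp, (sumFunctor A).map_id]
    change sumMap δ ≫ sumMap γ = _
    rw [hδ]
    exact IsIso.inv_hom_id (sumMap γ)

instance {A : Type u} [Groupoid.{u} A] {C D : FreeSMC A} (γ : C ⟶ D) : IsIso (sumMap γ) := by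
  rw [NatTrans.isIso_iff_isIso_app]
  intro a
  rw [isIso_iff_bijective]
  constructor
  · rintro ⟨i, m⟩ ⟨i', m'⟩ h
    obtain ⟨h₁, h₂⟩ := Sigma.ext_iff.1 h
    obtain rfl : i = i' := (Hom.ind γ).injective h₁
    exact Sigma.ext rfl (heq_of_eq ((cancel_mono (Hom.comp γ i)).1 (eq_of_heq h₂)))
  · rintro ⟨j, m⟩
    obtain ⟨i, rfl⟩ := (Hom.ind γ).surjective j
    exact ⟨⟨i, m ≫ inv (Hom.comp γ i)⟩, Sigma.ext rfl (heq_of_eq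
      ((Category.assoc _ _ _).trans (by rw [IsIso.inv_hom_id, Category.comp_id])))⟩

/-- The free symmetric monoidal completion of a groupoid is a groupoid. -/
instance {A : Type u} [Groupoid.{u} A] : IsGroupoid (FreeSMC A) where
  all_isIso γ := isIso_of_isIso_sumMap γ inferInstance

/-- A finite coproduct of finite sums of representables is again one, given by concatenation of
sequences. -/
theorem exists_isColimit_cofan {n : ℕ} (C : Fin n → FreeSMC A) :
    ∃ (E : FreeSMC A) (ι : ∀ i, sumObj (C i) ⟶ sumObj E),
      Nonempty (IsColimit (Cofan.mk (sumObj E) ι)) := by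
  let e : (Σ i, Fin (C i).card) ≃ Fin (∑ i, (C i).card) := finSigmaFinEquiv
  let E : FreeSMC A := ⟨∑ i, (C i).card, fun k => (C (e.symm k).1).obj (e.symm k).2⟩
  -- The objects at index `p` of the family `C` and at index `e p` of `E` are only
  -- propositionally equal, hence the transport.
  let el (p : Σ i, Fin (C i).card) : (sumObj E).obj (op ((C p.1).obj p.2)) :=
    ⟨e p, eqToHom (by
      change (C p.1).obj p.2 = (C (e.symm (e p)).1).obj (e.symm (e p)).2
      rw [e.symm_apply_apply])⟩
  have gen_eq : ∀ k : Fin E.card, E.gen k = el (e.symm k) := fun k => by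
    have : ∀ (k' : Fin E.card) (h : k' = k),
        (⟨k', eqToHom (by rw [h])⟩ : (sumObj E).obj (op (E.obj k))) = E.gen k := by
      rintro _ rfl; rfl
    exact (this (e (e.symm k)) (e.apply_symm_apply k)).symm
  have desc_el : ∀ {X : PSh A} (d : ∀ p : Σ i, Fin (C i).card, X.obj (op ((C p.1).obj p.2)))
      (p : Σ i, Fin (C i).card),
      (E.ofElements fun k => d (e.symm k)).app _ (el p) = d p := fun {X} d p => by
    have : ∀ (q : Σ i, Fin (C i).card) (h : q = p),
        X.map (eqToHom (by rw [h]) : (C p.1).obj p.2 ⟶ (C q.1).obj q.2).op (d q) = d p := by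
      rintro _ rfl; simp
    exact this _ (e.symm_apply_apply p)
  have hι : ∀ (i : Fin n) (j : Fin (C i).card),
      ((C i).ofElements fun j => el ⟨i, j⟩).app _ ((C i).gen j) = el ⟨i, j⟩ :=
    fun i j => ofElements_gen _ _ _
  refine ⟨E, fun i => (C i).ofElements fun j => el ⟨i, j⟩, ⟨Cofan.IsColimit.mk _
    (fun s => E.ofElements fun k => (s.inj (e.symm k).1).app _ ((C _).gen (e.symm k).2)) ?_ ?_⟩⟩
  · intro s i
    refine sumObj_hom_ext fun j => ?_
    refine Eq.trans (congrArg ((E.ofElements fun k => (s.inj (e.symm k).1).app _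
      ((C _).gen (e.symm k).2)).app _) (hι i j)) ?_
    exact desc_el (fun p => (s.inj p.1).app _ ((C p.1).gen p.2)) ⟨i, j⟩
  · intro s m h
    refine sumObj_hom_ext fun k => ?_
    rw [ofElements_gen, ← h, gen_eq]
    exact (congrArg _ (hι _ _)).symm

end FreeSMC

/-! ### Quasi-pullbacks of presheaves -/

section QuasiPullback

variable {A B : Type u} [Category.{u} A] [Category.{u} B]

/-- A square of presheaves is a quasi-pullback if and only if each compatible pair of elements has
a common preimage. -/
theorem isQuasiPullback_iff {Q X Y Z : PSh A} (h : Q ⟶ X) (k : Q ⟶ Y) (f : X ⟶ Z) (g : Y ⟶ Z) :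
    IsQuasiPullback h k f g ↔ h ≫ f = k ≫ g ∧
      ∀ (U : Aᵒᵖ) (x : X.obj U) (y : Y.obj U), f.app U x = g.app U y →
        ∃ q : Q.obj U, h.app U q = x ∧ k.app U q = y := by
  have hp : ∀ U : Aᵒᵖ, IsPullback ((pullback.fst f g).app U) ((pullback.snd f g).app U)
      (f.app U) (g.app U) := fun U =>
    (IsPullback.of_hasPullback f g).map ((evaluation Aᵒᵖ (Type u)).obj U)
  have fst_apply : ∀ (w : h ≫ f = k ≫ g) (U : Aᵒᵖ) (q : Q.obj U),
      (pullback.fst f g).app U ((pullback.lift h k w).app U q) = h.app U q := fun w U q =>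
    ConcreteCategory.congr_hom (congrArg (fun t => NatTrans.app t U) (pullback.lift_fst h k w)) q
  have snd_apply : ∀ (w : h ≫ f = k ≫ g) (U : Aᵒᵖ) (q : Q.obj U),
      (pullback.snd f g).app U ((pullback.lift h k w).app U q) = k.app U q := fun w U q =>
    ConcreteCategory.congr_hom (congrArg (fun t => NatTrans.app t U) (pullback.lift_snd h k w)) q
  constructor
  · rintro ⟨w, hepi⟩
    refine ⟨w, fun U x y hxy => ?_⟩
    obtain ⟨p, rfl, rfl⟩ := Types.exists_of_isPullback (hp U) x y hxy
    rw [NatTrans.epi_iff_epi_app] at hepi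
    obtain ⟨q, rfl⟩ := (epi_iff_surjective _).1 (hepi U) p
    exact ⟨q, (fst_apply w U q).symm, (snd_apply w U q).symm⟩
  · rintro ⟨w, H⟩
    refine ⟨w, ?_⟩
    rw [NatTrans.epi_iff_epi_app]
    intro U
    rw [epi_iff_surjective]
    intro p
    obtain ⟨q, hq₁, hq₂⟩ := H U ((pullback.fst f g).app U p) ((pullback.snd f g).app U p)
      (ConcreteCategory.congr_hom (hp U).w p)
    exact ⟨q, Types.ext_of_isPullback (hp U) ((fst_apply w U q).trans hq₁)
      ((snd_apply w U q).trans hq₂)⟩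

theorem quasiCartesian_iff {F G : PSh A ⥤ PSh B} (φ : F ⟶ G) :
    QuasiCartesian φ ↔ ∀ ⦃X Y : PSh A⦄ (f : X ⟶ Y) (U : Bᵒᵖ) (x : (F.obj Y).obj U)
      (y : (G.obj X).obj U), (φ.app Y).app U x = (G.map f).app U y →
        ∃ q : (F.obj X).obj U, (F.map f).app U q = x ∧ (φ.app X).app U q = y := by
  refine forall₃_congr fun X Y f => ?_
  rw [isQuasiPullback_iff, and_iff_right (φ.naturality f)]

theorem quasiCartesian_id (F : PSh A ⥤ PSh B) : QuasiCartesian (𝟙 F) :=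
  (quasiCartesian_iff _).2 fun _ _ _ _ _ y h => ⟨y, h.symm, rfl⟩

theorem QuasiCartesian.vcomp {F G H : PSh A ⥤ PSh B} {φ : F ⟶ G} {ψ : G ⟶ H}
    (hφ : QuasiCartesian φ) (hψ : QuasiCartesian ψ) : QuasiCartesian (φ ≫ ψ) := by
  rw [quasiCartesian_iff] at *
  intro X Y f U x y h
  obtain ⟨q, hq, rfl⟩ := hψ f U ((φ.app Y).app U x) y h
  obtain ⟨r, rfl, rfl⟩ := hφ f U x q hq.symm
  exact ⟨r, rfl, rfl⟩

end QuasiPullback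

/-! ### Generic elements -/

section Generic

variable {A B D : Type u} [Category.{u} A] [Category.{u} B] [Category.{u} D]

theorem map_comp_app_apply (F : PSh A ⥤ PSh B) {X Y Z : PSh A} (f : X ⟶ Y) (g : Y ⟶ Z) (U : Bᵒᵖ)
    (x : (F.obj X).obj U) :
    (F.map (f ≫ g)).app U x = (F.map g).app U ((F.map f).app U x) := by
  rw [F.map_comp]; rfl

theorem map_id_app_apply (F : PSh A ⥤ PSh B) (X : PSh A) (U : Bᵒᵖ) (x : (F.obj X).obj U) :
    (F.map (𝟙 X)).app U x = x := by
  rw [F.map_id]; rfl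

/-- An element `t` of `F T` is generic if whenever its image under `F a`, with `a : T ⟶ Z`, is also
the image of some `y` under `F b`, with `b : Y ⟶ Z`, there is a lift `c : T ⟶ Y` of `a` through `b`
such that `F c` takes `t` to `y`. The lift is not required to be unique. -/
def IsGeneric (F : PSh A ⥤ PSh B) {T : PSh A} {U : Bᵒᵖ} (t : (F.obj T).obj U) : Prop :=
  ∀ ⦃Y Z : PSh A⦄ (a : T ⟶ Z) (b : Y ⟶ Z) (y : (F.obj Y).obj U),
    (F.map b).app U y = (F.map a).app U t → ∃ c : T ⟶ Y, c ≫ b = a ∧ (F.map c).app U t = y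

/-- `F` has enough generics if each of its elements is the image of a generic element over a finite
sum of representables. -/
def HasEnoughGenerics (F : PSh A ⥤ PSh B) : Prop :=
  ∀ (X : PSh A) (U : Bᵒᵖ) (x : (F.obj X).obj U),
    ∃ (C : FreeSMC A) (t : (F.obj (FreeSMC.sumObj C)).obj U) (f : FreeSMC.sumObj C ⟶ X),
      IsGeneric F t ∧ (F.map f).app U t = x

theorem IsGeneric.map {F : PSh A ⥤ PSh B} {T T' : PSh A} {U : Bᵒᵖ} {t : (F.obj T).obj U}
    (ht : IsGeneric F t) (e : T ⟶ T') [IsIso e] : IsGeneric F ((F.map e).app U t) := by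
  intro Y Z a b y h
  rw [← map_comp_app_apply] at h
  obtain ⟨c, hc, rfl⟩ := ht _ b y h
  refine ⟨inv e ≫ c, by rw [Category.assoc, hc, IsIso.inv_hom_id_assoc], ?_⟩
  rw [← map_comp_app_apply, IsIso.hom_inv_id_assoc]

theorem IsGeneric.restrict {F : PSh A ⥤ PSh B} {T : PSh A} {U V : Bᵒᵖ} {t : (F.obj T).obj U}
    (ht : IsGeneric F t) (v : U ⟶ V) [IsIso v] : IsGeneric F ((F.obj T).map v t) := by
  have hv : ∀ (X : PSh A) (x : (F.obj X).obj U), (F.obj X).map (inv v) ((F.obj X).map v x) = x :=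
    fun X x => by rw [← Functor.map_comp_apply, IsIso.hom_inv_id, Functor.map_id_apply]
  have hv' : ∀ (X : PSh A) (x : (F.obj X).obj V), (F.obj X).map v ((F.obj X).map (inv v) x) = x :=
    fun X x => by rw [← Functor.map_comp_apply, IsIso.inv_hom_id, Functor.map_id_apply]
  intro Y Z a b y h
  obtain ⟨c, hc, hct⟩ := ht a b ((F.obj Y).map (inv v) y) (by
    rw [NatTrans.naturality_apply, h, NatTrans.naturality_apply, hv])
  exact ⟨c, hc, by rw [NatTrans.naturality_apply, hct, hv']⟩

/-- Generic elements are unique up to isomorphism: a comparison map between the objects over which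
two of them live is invertible. -/
theorem IsGeneric.isIso {F : PSh A ⥤ PSh B} {T T' : PSh A} {U : Bᵒᵖ} {t : (F.obj T).obj U}
    {t' : (F.obj T').obj U} (ht : IsGeneric F t) (ht' : IsGeneric F t') (c : T ⟶ T')
    (hc : (F.map c).app U t = t') : IsIso c := by
  obtain ⟨d, hd, hdt⟩ := ht' (𝟙 T') c t (by rw [hc, map_id_app_apply])
  obtain ⟨e, he, -⟩ := ht (𝟙 T) d t' (by rw [hdt, map_id_app_apply])
  -- `d` has the right inverse `c` and the left inverse `e`, so these agree.
  obtain rfl : e = c := by rw [← Category.comp_id e, ← hd, reassoc_of% he]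
  exact ⟨d, he, hd⟩

theorem hasEnoughGenerics_id : HasEnoughGenerics (𝟭 (PSh A)) := by
  intro X U x
  let C : FreeSMC A := ⟨1, fun _ => unop U⟩
  refine ⟨C, C.gen 0, C.ofElements fun _ => x, fun Y Z a b y h => ?_,
    C.ofElements_gen (X := X) (fun _ => x) 0⟩
  refine ⟨C.ofElements fun _ => y, FreeSMC.sumObj_hom_ext fun i => ?_,
    C.ofElements_gen (X := Y) (fun _ => y) 0⟩
  obtain rfl : i = 0 := Subsingleton.elim (α := Fin 1) i 0
  exact (congrArg _ (C.ofElements_gen (fun _ => y) 0)).trans h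

/-- Generic elements compose. A generic element `t` of `L` over `S D` together with, for each index
`i` of `D`, a generic element of `F` over some `S (C i)` yields the element of `F ⋙ L` over the sum
of the `S (C i)` that is the image of `t`. -/
theorem HasEnoughGenerics.comp {F : PSh A ⥤ PSh B} {L : PSh B ⥤ PSh D} (hF : HasEnoughGenerics F)
    (hL : HasEnoughGenerics L) : HasEnoughGenerics (F ⋙ L) := by
  intro X U x
  obtain ⟨D, t, f, ht, rfl⟩ := hL (F.obj X) U x
  choose C s g hs hg using fun i => hF X _ (f.app _ (D.gen i))
  obtain ⟨E, ι, ⟨hE⟩⟩ := FreeSMC.exists_isColimit_cofan C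
  let r : FreeSMC.sumObj D ⟶ F.obj (FreeSMC.sumObj E) :=
    D.ofElements fun i => (F.map (ι i)).app _ (s i)
  have hr : ∀ i, r.app _ (D.gen i) = (F.map (ι i)).app _ (s i) := D.ofElements_gen _
  have hdesc : ∀ {X : PSh A} (d : ∀ i, FreeSMC.sumObj (C i) ⟶ X) (i),
      ι i ≫ Cofan.IsColimit.desc hE d = d i := fun d i => Cofan.IsColimit.fac hE d i
  have hrg : ∀ {X : PSh A} (d : ∀ i, FreeSMC.sumObj (C i) ⟶ X) (i),
      (r ≫ F.map (Cofan.IsColimit.desc hE d)).app _ (D.gen i) = (F.map (d i)).app _ (s i) :=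
    fun d i => by
      rw [← hdesc d i, map_comp_app_apply, ← hr]; rfl
  refine ⟨E, (L.map r).app U t, Cofan.IsColimit.desc hE g, fun Y Z a b y h => ?_, ?_⟩
  · obtain ⟨c, hc, rfl⟩ := ht (r ≫ F.map a) (F.map b) y (by rw [map_comp_app_apply]; exact h)
    have hci : ∀ i, (F.map b).app _ (c.app _ (D.gen i)) = (F.map (ι i ≫ a)).app _ (s i) :=
      fun i => by
        rw [map_comp_app_apply, ← hr]
        exact ConcreteCategory.congr_hom (congrArg (fun t => NatTrans.app t _) hc) (D.gen i)
    choose d hd hds using fun i => hs i (ι i ≫ a) b _ (hci i)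
    refine ⟨Cofan.IsColimit.desc hE d, Cofan.IsColimit.hom_ext hE _ _ fun i => ?_, ?_⟩
    · change ι i ≫ _ = ι i ≫ _
      rw [← Category.assoc, hdesc, hd]
    · refine (map_comp_app_apply L _ _ _ _).symm.trans ?_
      congr 2
      have : r ≫ F.map (Cofan.IsColimit.desc hE d) = c :=
        FreeSMC.sumObj_hom_ext fun i => (hrg d i).trans (hds i)
      rw [this]
  · refine (map_comp_app_apply L _ _ _ _).symm.trans ?_
    have : r ≫ F.map (Cofan.IsColimit.desc hE g) = f :=
      FreeSMC.sumObj_hom_ext fun i => (hrg g i).trans (hg i)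
    rw [this]

/-- A functor with enough generics preserves quasi-pullbacks: a compatible pair of elements is the
image of a single generic element, and finite sums of representables are projective. -/
theorem HasEnoughGenerics.map_isQuasiPullback {F : PSh A ⥤ PSh B} (hF : HasEnoughGenerics F)
    {Q X Y Z : PSh A} {h : Q ⟶ X} {k : Q ⟶ Y} {f : X ⟶ Z} {g : Y ⟶ Z}
    (H : IsQuasiPullback h k f g) :
    IsQuasiPullback (F.map h) (F.map k) (F.map f) (F.map g) := by
  rw [isQuasiPullback_iff] at *
  obtain ⟨w, H⟩ := H
  refine ⟨by rw [← F.map_comp, w, F.map_comp], fun U x y hxy => ?_⟩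
  obtain ⟨C, t, p, ht, rfl⟩ := hF X U x
  obtain ⟨c, hc, rfl⟩ := ht (p ≫ f) g y (by rw [map_comp_app_apply]; exact hxy.symm)
  choose q hq₁ hq₂ using fun i => H _ (p.app _ (C.gen i)) (c.app _ (C.gen i))
    (ConcreteCategory.congr_hom (congrArg (fun t => NatTrans.app t _) hc.symm) (C.gen i))
  refine ⟨(F.map (C.ofElements q)).app U t, ?_, ?_⟩
  · rw [← map_comp_app_apply]
    have : C.ofElements q ≫ h = p := FreeSMC.sumObj_hom_ext fun i =>
      (congrArg _ (C.ofElements_gen q i)).trans (hq₁ i)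
    rw [this]
  · rw [← map_comp_app_apply]
    have : C.ofElements q ≫ k = c := FreeSMC.sumObj_hom_ext fun i =>
      (congrArg _ (C.ofElements_gen q i)).trans (hq₂ i)
    rw [this]

theorem QuasiCartesian.hcomp {F F' : PSh A ⥤ PSh B} {L L' : PSh B ⥤ PSh D} {φ : F ⟶ F'}
    {ψ : L ⟶ L'} (hL' : HasEnoughGenerics L') (hφ : QuasiCartesian φ) (hψ : QuasiCartesian ψ) :
    QuasiCartesian (φ ◫ ψ) := by
  refine (quasiCartesian_iff _).2 fun X Y f U x y h => ?_
  obtain ⟨q, hq, rfl⟩ := ((isQuasiPullback_iff _ _ _ _).1 (hL'.map_isQuasiPullback (hφ f))).2 U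
    ((ψ.app (F.obj Y)).app U x) y h
  obtain ⟨r, rfl, rfl⟩ := (quasiCartesian_iff ψ).1 hψ (F.map f) U x q hq.symm
  exact ⟨r, rfl, rfl⟩

end Generic

/-! ### Analytic functors and generic elements -/

section Analytic

variable {A B : Type u}

/-- Elements of a colimit of sets indexed by a groupoid are equal only if they are related by a
single morphism. -/
theorem exists_map_eq_of_ι_eq {J : Type*} [Category* J] [IsGroupoid J] {P : J ⥤ Type u}
    {c : Cocone P} (hc : IsColimit c) {j j' : J} {x : P.obj j} {x' : P.obj j'}
    (h : c.ι.app j x = c.ι.app j' x') : ∃ γ : j ⟶ j', P.map γ x = x' := by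
  have hb := ((Types.isColimit_iff_coconeTypesIsColimit c).1 ⟨hc⟩).bijective.1
  have h' : P.ιColimitType j x = P.ιColimitType j' x' := hb h
  rw [Functor.ιColimitType_eq_iff] at h'
  suffices ∀ p p' : Σ j, P.obj j, Relation.EqvGen P.ColimitTypeRel p p' →
      ∃ γ : p.1 ⟶ p'.1, P.map γ p.2 = p'.2 from this _ _ h'
  intro p p' hp
  induction hp with
  | rel p p' h => exact h.imp fun _ => Eq.symm
  | refl p => exact ⟨𝟙 _, by simp⟩
  | symm p p' _ ih =>
    obtain ⟨γ, hγ⟩ := ih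
    refine ⟨inv γ, ?_⟩
    rw [← hγ, ← Functor.map_comp_apply, IsIso.hom_inv_id, Functor.map_id_apply]
  | trans p p' p'' _ _ ih ih' =>
    obtain ⟨γ, hγ⟩ := ih
    obtain ⟨γ', hγ'⟩ := ih'
    exact ⟨γ ≫ γ', by rw [Functor.map_comp_apply, hγ, hγ']⟩

/-- The elements of the coefficient presheaves `P C` are generic, because equality of elements of
the colimits over comma categories which compute the Kan extension is witnessed by single maps,
these comma categories being groupoids. -/
theorem IsAnalytic.hasEnoughGenerics [Groupoid.{u} A] [Category.{u} B] {F : PSh A ⥤ PSh B}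
    (hF : IsAnalytic F) : HasEnoughGenerics F := by
  obtain ⟨P, α, hα⟩ := hF
  have hcolim (X : PSh A) (U : Bᵒᵖ) := isColimitOfPreserves ((evaluation Bᵒᵖ (Type u)).obj U)
    (Functor.isPointwiseLeftKanExtensionOfIsLeftKanExtension F α X)
  have hgpd (X : PSh A) : IsGroupoid (CostructuredArrow (FreeSMC.sumFunctor A) X) :=
    ⟨fun γ => isIso_of_reflects_iso γ (CostructuredArrow.proj (FreeSMC.sumFunctor A) X)⟩
  have hsurj (X : PSh A) (U : Bᵒᵖ) (x : (F.obj X).obj U) :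
      ∃ (C : FreeSMC A) (p : (P.obj C).obj U) (f : FreeSMC.sumObj C ⟶ X),
        (F.map f).app U ((α.app C).app U p) = x := by
    obtain ⟨j, p, hp⟩ := Types.jointly_surjective_of_isColimit (hcolim X U) x
    exact ⟨j.left, p, j.hom, hp⟩
  intro X U x
  obtain ⟨C, p, f, hf⟩ := hsurj X U x
  refine ⟨C, (α.app C).app U p, f, fun Y Z a b y h => ?_, hf⟩
  obtain ⟨C', p', f', rfl⟩ := hsurj Y U y
  have h : (F.map (f' ≫ b)).app U ((α.app C').app U p') = (F.map a).app U ((α.app C).app U p) :=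
    (map_comp_app_apply F f' b U _).trans h
  obtain ⟨γ, hγ⟩ := exists_map_eq_of_ι_eq (hcolim Z U)
    (j := CostructuredArrow.mk (Y := C) (S := FreeSMC.sumFunctor A) a)
    (j' := CostructuredArrow.mk (Y := C') (S := FreeSMC.sumFunctor A) (f' ≫ b))
    (x := p) (x' := p') h.symm
  have hγa : FreeSMC.sumMap γ.left ≫ f' ≫ b = a := CostructuredArrow.w γ
  have hγp : (P.map γ.left).app U p = p' := hγ
  refine ⟨FreeSMC.sumMap γ.left ≫ f', by rw [Category.assoc, hγa], ?_⟩
  rw [← hγp]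
  refine (map_comp_app_apply F _ f' U _).trans (congrArg ((F.map f').app U) ?_)
  exact (ConcreteCategory.congr_hom
    (congrArg (fun t => NatTrans.app t U) (α.naturality γ.left)) p).symm

/-- The coefficients of a functor `F` between presheaf categories over groupoids: the presheaves of
generic elements of `F` over finite sums of representables. -/
def genericCoefficients [Groupoid.{u} A] [Groupoid.{u} B] (F : PSh A ⥤ PSh B) :
    FreeSMC A ⥤ PSh B where
  obj C :=
    { obj U := {t : (F.obj (FreeSMC.sumObj C)).obj U // IsGeneric F t}
      map v := TypeCat.ofHom fun t => ⟨(F.obj (FreeSMC.sumObj C)).map v t.1,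
        have : IsIso v := inferInstanceAs (IsIso v.unop.op)
        t.2.restrict v⟩
      map_id U := by
        ext t
        exact (F.obj (FreeSMC.sumObj C)).map_id_apply U t.1
      map_comp v w := by
        ext t
        exact (F.obj (FreeSMC.sumObj C)).map_comp_apply v w t.1 }
  map γ :=
    { app U := TypeCat.ofHom fun t =>
        ⟨(F.map (FreeSMC.sumMap γ)).app U t.1, t.2.map (FreeSMC.sumMap γ)⟩
      naturality U V v := by
        ext t
        exact NatTrans.naturality_apply (F.map (FreeSMC.sumMap γ)) v t.1 }
  map_id C := by
    ext U t
    change (F.map ((FreeSMC.sumFunctor A).map (𝟙 C))).app U t.1 = t.1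
    rw [(FreeSMC.sumFunctor A).map_id]
    exact map_id_app_apply F _ U t.1
  map_comp γ δ := by
    ext U t
    change (F.map ((FreeSMC.sumFunctor A).map (γ ≫ δ))).app U t.1 = _
    rw [(FreeSMC.sumFunctor A).map_comp]
    exact map_comp_app_apply F _ _ U t.1

/-- The inclusion of the generic elements of `F` into all elements. -/
def genericInclusion [Groupoid.{u} A] [Groupoid.{u} B] (F : PSh A ⥤ PSh B) :
    genericCoefficients F ⟶ FreeSMC.sumFunctor A ⋙ F where
  app C := { app U := TypeCat.ofHom fun t => t.1 }

/-- `F` is the left Kan extension of its generic coefficients: each element comes from a generic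
one, which is unique up to isomorphism, and the isomorphisms between finite sums of representables
come from `!A`. -/
theorem HasEnoughGenerics.isAnalytic [Groupoid.{u} A] [Groupoid.{u} B] {F : PSh A ⥤ PSh B}
    (hF : HasEnoughGenerics F) : IsAnalytic F := by
  refine ⟨genericCoefficients F, genericInclusion F, ?_⟩
  suffices h : (Functor.LeftExtension.mk F (genericInclusion F)).IsPointwiseLeftKanExtension from
    h.isLeftKanExtension
  intro X
  refine evaluationJointlyReflectsColimits _ fun U => Nonempty.some ?_
  rw [Types.isColimit_iff_coconeTypesIsColimit]
  refine ⟨⟨fun p p' h => ?_, ?_⟩⟩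
  · obtain ⟨j, t, rfl⟩ := Functor.ιColimitType_jointly_surjective _ p
    obtain ⟨j', t', rfl⟩ := Functor.ιColimitType_jointly_surjective _ p'
    have h' : (F.map j.hom).app U t.1 = (F.map j'.hom).app U t'.1 := h
    obtain ⟨c, hc, hct⟩ := t.2 j.hom j'.hom t'.1 h'.symm
    have hiso : @IsIso (PSh A) _ (FreeSMC.sumObj j.left) (FreeSMC.sumObj j'.left) c :=
      t.2.isIso t'.2 c hct
    obtain ⟨γ, hγ⟩ := FreeSMC.exists_sumMap_eq 
      (@asIso (PSh A) _ (FreeSMC.sumObj j.left) (FreeSMC.sumObj j'.left) c hiso)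
    let γ' : j ⟶ j' := CostructuredArrow.homMk γ (by
      refine Eq.trans ?_ hc
      exact congrArg (· ≫ j'.hom) hγ)
    refine Quot.sound ⟨γ', Subtype.ext ?_⟩
    change t'.1 = (F.map (FreeSMC.sumMap γ)).app U t.1
    rw [hγ]
    exact hct.symm
  · rw [Functor.CoconeTypes.descColimitType_surjective_iff]
    intro x
    obtain ⟨C, t, f, ht, hf⟩ := hF X U x
    exact ⟨CostructuredArrow.mk (Y := C) (S := FreeSMC.sumFunctor A) f, ⟨t, ht⟩, hf⟩

end Analytic

end AnalyticFunctors

open AnalyticFunctors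
theorem mainTheorem3 :
    ∃ (id_analytic : ∀ (G : Type u) [Groupoid.{u} G], IsAnalytic (𝟭 (PSh G)))
      (comp_analytic : ∀ (G H K : Type u) [Groupoid.{u} G] [Groupoid.{u} H] [Groupoid.{u} K]
        (F : PSh G ⥤ PSh H) (L : PSh H ⥤ PSh K),
        IsAnalytic F → IsAnalytic L → IsAnalytic (F ⋙ L))
      (id_quasiCartesian : ∀ (G H : Type u) [Groupoid.{u} G] [Groupoid.{u} H]
        (F : PSh G ⥤ PSh H), IsAnalytic F → QuasiCartesian (𝟙 F))
      (vcomp_quasiCartesian : ∀ (G H : Type u) [Groupoid.{u} G] [Groupoid.{u} H]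
        (F F' F'' : PSh G ⥤ PSh H) (φ : F ⟶ F') (ψ : F' ⟶ F''),
        IsAnalytic F → IsAnalytic F' → IsAnalytic F'' →
        QuasiCartesian φ → QuasiCartesian ψ → QuasiCartesian (φ ≫ ψ))
      (hcomp_quasiCartesian : ∀ (G H K : Type u)
        [Groupoid.{u} G] [Groupoid.{u} H] [Groupoid.{u} K]
        (F F' : PSh G ⥤ PSh H) (L L' : PSh H ⥤ PSh K) (φ : F ⟶ F') (ψ : L ⟶ L'),
        IsAnalytic F → IsAnalytic F' → IsAnalytic L → IsAnalytic L' →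
        QuasiCartesian φ → QuasiCartesian ψ → QuasiCartesian (φ ◫ ψ)),
      @Bicategory.Strict AF.{u} (AF.bicategory
        ⟨id_analytic, comp_analytic, id_quasiCartesian, vcomp_quasiCartesian,
          hcomp_quasiCartesian⟩) := by
  refine ⟨fun G _ => hasEnoughGenerics_id.isAnalytic,
    fun G H K _ _ _ F L hF hL => (hF.hasEnoughGenerics.comp hL.hasEnoughGenerics).isAnalytic,
    fun G H _ _ F _ => quasiCartesian_id F,
    fun G H _ _ F F' F'' φ ψ _ _ _ hφ hψ => hφ.vcomp hψ,
    fun G H K _ _ _ F F' L L' φ ψ _ _ _ hL' hφ hψ => hφ.hcomp hL'.hasEnoughGenerics hψ, ?_⟩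
  -- All coherence isomorphisms are identities, and composition of functors is strict by `rfl`.
  exact @Bicategory.Strict.mk AF.{u} (AF.bicategory _) (fun _ => rfl) (fun _ => rfl)
    (fun _ _ _ => rfl) (fun _ => rfl) (fun _ => rfl) (fun _ _ _ => rfl)
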